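/- Let $N\ge 2$, $d\ge 1$, and let $G$ be a connected undirected weighted graph on the nodes $\{1,\dots,N\}$: $\sim$ is a neighbouring relation with $x\sim x$ for all $x$, and $\omega(x,y)=\omega(y,x)\ge 0$ are weights with $\omega(x,y)>0\Leftrightarrow x\sim y$; connected means that any two nodes are joined by a finite sequence of successive neighbours. For $f:\{1,\dots,N\}\to\mathbb{R}^d$ put $\Delta f(x)=\sum_{y\sim x}\omega(x,y)\,(f(y)-f(x))$, and let $H^1$ be the space of all such $f$ with zero average, $\frac1N\sum_x f(x)=0$, with the norm $\|f\|^2=\sum_x\|f(x)\|^2$; $\Delta$ maps $H^1$ to itself. Let $\|\Delta\|$ be the largest modulus of an eigenvalue of $\Delta$ on $H^1$. Let $\bar\tau\ge 0$. For $0\le\tau\le\bar\tau$ consider $$\dot v_1(x,t)=\Delta v_1(x,t-\tau),\quad t>0,\qquad v_1(\cdot,t)\in H^1,$$ with continuous initial conditions $\varphi:[-\bar\tau,0]\to H^1$. The zero solution is called globally exponentially stable if there are $K,\gamma>0$ such that every solution $v_1$ (continuous on $[-\bar\tau,\infty)$, equal to $\varphi$ on $[-\bar\tau,0]$), for every initial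 condition $\varphi$, satisfies $\|v_1(\cdot,t)\|\le K e^{-\gamma t}\sup_{s\in[-\bar\tau,0]}\|\varphi(s)\|$ for all $t\ge 0$. **Theorem (constant delay, uniform).** The zero solution is globally exponentially stable for every $\tau\in[0,\bar\tau]$ if and only if $$\bar\tau<\frac{\pi}{2\|\Delta\|}.$$ -/

import Mathlib

namespace DelayPdE

/-- An undirected weighted graph on the nodes `Fin N`: a symmetric relation `Adj` with
`x ∼ x` for every node, and symmetric nonnegative weights that are positive exactly on
neighbouring nodes. -/
structure WeightedGraph (N : ℕ) where
  Adj : Fin N → Fin N → Prop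
  adj_self : ∀ x, Adj x x
  weight : Fin N → Fin N → ℝ
  weight_nonneg : ∀ x y, 0 ≤ weight x y
  weight_symm : ∀ x y, weight x y = weight y x
  weight_pos_iff : ∀ x y, 0 < weight x y ↔ Adj x y

/-- Each pair of nodes is joined by a finite sequence of successive neighbours. -/
def WeightedGraph.Connected {N : ℕ} (G : WeightedGraph N) : Prop :=
  ∀ x y, Relation.ReflTransGen G.Adj x y

/-- Functions `f` from the nodes to `ℝ^d`, with `‖f‖² = ∑ₓ ‖f x‖²` and the corresponding
scalar product `(f, g) = ∑ₓ f x · g x`. -/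
def L2 (N d : ℕ) : Type := PiLp 2 (fun _ : Fin N => EuclideanSpace ℝ (Fin d))

noncomputable instance (N d : ℕ) : NormedAddCommGroup (L2 N d) :=
  inferInstanceAs (NormedAddCommGroup (PiLp 2 (fun _ : Fin N => EuclideanSpace ℝ (Fin d))))

noncomputable instance (N d : ℕ) : InnerProductSpace ℝ (L2 N d) :=
  inferInstanceAs (InnerProductSpace ℝ (PiLp 2 (fun _ : Fin N => EuclideanSpace ℝ (Fin d))))

instance (N d : ℕ) : FiniteDimensional ℝ (L2 N d) :=
  inferInstanceAs (FiniteDimensional ℝ (PiLp 2 (fun _ : Fin N => EuclideanSpace ℝ (Fin d))))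

namespace L2

/-- The value of `f` at the node `x`. -/
def eval {N d : ℕ} (f : L2 N d) (x : Fin N) : EuclideanSpace ℝ (Fin d) :=
  (show PiLp 2 (fun _ : Fin N => EuclideanSpace ℝ (Fin d)) from f) x

instance (N d : ℕ) : CoeFun (L2 N d) (fun _ => Fin N → EuclideanSpace ℝ (Fin d)) := ⟨eval⟩

/-- A function on the nodes, as an element of `L2`. -/
def ofFun {N d : ℕ} (g : Fin N → EuclideanSpace ℝ (Fin d)) : L2 N d := WithLp.toLp 2 g

@[simp] theorem ofFun_apply {N d : ℕ} (g : Fin N → EuclideanSpace ℝ (Fin d)) (x : Fin N) :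
    ofFun g x = g x := rfl

@[simp] theorem zero_apply {N d : ℕ} (x : Fin N) : (0 : L2 N d) x = 0 := rfl

@[simp] theorem add_apply {N d : ℕ} (f g : L2 N d) (x : Fin N) : (f + g) x = f x + g x := rfl

@[simp] theorem smul_apply {N d : ℕ} (c : ℝ) (f : L2 N d) (x : Fin N) :
    (c • f) x = c • f x := rfl

@[ext] theorem ext {N d : ℕ} {f g : L2 N d} (h : ∀ x, f x = g x) : f = g :=
  PiLp.ext h

theorem inner_eq_sum {N d : ℕ} (f g : L2 N d) : inner ℝ f g = ∑ x, inner ℝ (f x) (g x) := rfl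

theorem norm_sq_eq_sum {N d : ℕ} (f : L2 N d) : ‖f‖ ^ 2 = ∑ x, ‖f x‖ ^ 2 :=
  PiLp.norm_sq_eq_of_L2 (fun _ : Fin N => EuclideanSpace ℝ (Fin d)) f

end L2

/-- The average `(1 / N) ∑ₓ f x`. -/
noncomputable def average {N d : ℕ} (f : L2 N d) : EuclideanSpace ℝ (Fin d) :=
  (N : ℝ)⁻¹ • ∑ x, f x

/-- The subspace of functions with zero average. -/
noncomputable def H1 (N d : ℕ) : Submodule ℝ (L2 N d) where
  carrier := {f | average f = 0}
  zero_mem' := by simp [average]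
  add_mem' := by
    intro f g hf hg
    simp only [average, Set.mem_ofPred_eq] at hf hg ⊢
    simp only [L2.add_apply, Finset.sum_add_distrib, smul_add, hf, hg, add_zero]
  smul_mem' := by
    intro c f hf
    simp only [average, Set.mem_ofPred_eq] at hf ⊢
    simp only [L2.smul_apply, ← Finset.smul_sum]
    rw [smul_comm, hf, smul_zero]

/-- The partial derivative `∂_y f (x) = f y - f x`. -/
def partialDeriv {N d : ℕ} (y : Fin N) (f : L2 N d) (x : Fin N) : EuclideanSpace ℝ (Fin d) :=
  f y - f x

/-- The Laplacian `Δ f (x) = ∑_y ω(x, y) ∂_y f (x)`. The terms with `y ≁ x` vanish, since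
their weights do. -/
noncomputable def laplacian {N : ℕ} (G : WeightedGraph N) (d : ℕ) : L2 N d →ₗ[ℝ] L2 N d where
  toFun f := L2.ofFun (fun x => ∑ y, G.weight x y • partialDeriv y f x)
  map_add' f g := by
    ext1 x
    simp only [partialDeriv, L2.ofFun_apply, L2.add_apply, ← Finset.sum_add_distrib]
    refine Finset.sum_congr rfl fun y _ => ?_
    module
  map_smul' c f := by
    ext1 x
    simp only [partialDeriv, L2.ofFun_apply, L2.smul_apply, Finset.smul_sum, RingHom.id_apply]
    refine Finset.sum_congr rfl fun y _ => ?_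
    module

theorem laplacian_mem_H1 {N : ℕ} (G : WeightedGraph N) (d : ℕ) (f : L2 N d) :
    laplacian G d f ∈ H1 N d := by
  have h : ∑ x, ∑ y, G.weight x y • partialDeriv y f x = 0 := by
    have h1 : ∑ x, ∑ y, G.weight x y • f y = ∑ x, ∑ y, G.weight x y • f x := by
      rw [Finset.sum_comm]
      simp only [G.weight_symm]
    simp only [partialDeriv, smul_sub, Finset.sum_sub_distrib]
    rw [h1, sub_self]
  change (N : ℝ)⁻¹ • ∑ x, ∑ y, G.weight x y • partialDeriv y f x = 0
  rw [h, smul_zero]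

/-- The Laplacian as an operator from `H1` to `H1`. -/
noncomputable def laplacianH1 {N : ℕ} (G : WeightedGraph N) (d : ℕ) :
    H1 N d →ₗ[ℝ] H1 N d :=
  (laplacian G d).restrict fun f _ => laplacian_mem_H1 G d f

/-- `‖Δ‖`: the largest modulus of an eigenvalue of the Laplacian on `H1`. (The set is finite,
and nonempty as soon as `H1` is not zero, so that the supremum is a maximum.) -/
noncomputable def laplacianNorm {N : ℕ} (G : WeightedGraph N) (d : ℕ) : ℝ :=
  sSup {r : ℝ | ∃ μ : ℝ, Module.End.HasEigenvalue (laplacianH1 G d) μ ∧ r = |μ|}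

/-- `v` solves `v'(t) = Δ v(t - τ)` for `t > 0`, with the continuous initial condition `φ`
on `[-τbar, 0]`, where `0 ≤ τ ≤ τbar`. -/
structure IsSolution {N d : ℕ} (G : WeightedGraph N) (τ τbar : ℝ)
    (φ : C(Set.Icc (-τbar) 0, H1 N d)) (v : ℝ → H1 N d) : Prop where
  initial : ∀ s : Set.Icc (-τbar) 0, v s = φ s
  continuousOn : ContinuousOn v (Set.Ici (-τbar))
  hasDerivAt : ∀ t : ℝ, 0 < t → HasDerivAt v (laplacianH1 G d (v (t - τ))) t

/-- Global exponential stability of the zero solution of `v'(t) = Δ v(t - τ)` on `H1`;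
`‖φ‖` is the supremum norm of the initial condition. -/
def GloballyExponentiallyStable {N : ℕ} (G : WeightedGraph N) (d : ℕ) (τ τbar : ℝ) : Prop :=
  ∃ K γ : ℝ, 0 < K ∧ 0 < γ ∧
    ∀ (φ : C(Set.Icc (-τbar) 0, H1 N d)) (v : ℝ → H1 N d), IsSolution G τ τbar φ v →
      ∀ t : ℝ, 0 ≤ t → ‖v t‖ ≤ K * Real.exp (-γ * t) * ‖φ‖

end DelayPdE

/-!
The Laplacian on `H1` is symmetric, and by Green's formula (`inner_laplacian`) its quadratic form
is minus one half of the Dirichlet form. On a connected graph it is therefore negative definite on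
functions with zero average, and the system splits orthogonally into scalar equations
`u' (t) = -a u (t - τ)` with `0 < a ≤ ‖Δ‖`, the value `a = ‖Δ‖` being attained. The theorem thus
says that such an equation is exponentially stable when `a τ < π / 2`, and that stability is lost
at `a τ = π / 2`, where `cos (a t)` is a solution (`not_globallyExponentiallyStable_critical`).

For the stability of the scalar equation, rescale the delay to one. The restrictions of a solution
to successive unit intervals are then the iterates, on the Banach space `C([0, 1], ℂ)`, of the
operator `T φ (s) = φ 1 - c ∫₀ˢ φ`, with `c = a τ` (`IsScalarSolution.profile_succ`). This operator
is compact (`isCompactOperator_stepOp`), so by the Fredholm alternative the nonzero points of its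
spectrum are eigenvalues, and these satisfy the characteristic equation `exp (-c / μ) = μ`
(`exp_eq_of_hasEigenvalue_stepOp`). For `0 < c < π / 2` all roots of that equation lie in the open
unit disc (`norm_lt_one_of_exp_eq`). Hence the spectral radius of `T` is less than one, and
Gelfand's formula makes the powers of `T` decay geometrically, which is exponential decay in time
with constants independent of the solution (`exists_scalar_decay`).
-/

open Filter Topology
open scoped ENNReal

/-! ### Power bounds from the spectral radius -/

/-- By Gelfand's formula, the powers of an element of spectral radius less than one decay
geometrically. -/
theorem exists_norm_pow_le_of_spectralRadius_lt_one {A : Type*} [NormedRing A]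
    [NormedAlgebra ℂ A] [CompleteSpace A] (a : A) (h : spectralRadius ℂ a < 1) :
    ∃ C q : ℝ, 0 < C ∧ 0 < q ∧ q < 1 ∧ ∀ n : ℕ, ‖a ^ n‖ ≤ C * q ^ n := by
  obtain ⟨q', hq1, hq2⟩ := ENNReal.lt_iff_exists_nnreal_btwn.1 h
  have hq0 : 0 < q' := by
    have := (zero_le (a := spectralRadius ℂ a)).trans_lt hq1
    exact_mod_cast this
  have hq2' : q' < 1 := by exact_mod_cast hq2
  have hev : ∀ᶠ n : ℕ in atTop, ‖a ^ n‖ ≤ (q' : ℝ) ^ n := by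
    filter_upwards [(spectrum.pow_nnnorm_pow_one_div_tendsto_nhds_spectralRadius a).eventually
      (gt_mem_nhds hq1), eventually_gt_atTop 0] with n hn hn0
    have hn0' : (n : ℝ) ≠ 0 := by positivity
    have h1 : ((‖a ^ n‖₊ : ℝ≥0∞) ^ (1 / n : ℝ)) ^ (n : ℝ) ≤ (q' : ℝ≥0∞) ^ (n : ℝ) :=
      ENNReal.rpow_le_rpow hn.le (by positivity)
    rw [← ENNReal.rpow_mul, one_div, inv_mul_cancel₀ hn0', ENNReal.rpow_one,
      ENNReal.rpow_natCast] at h1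
    have h2 : ‖a ^ n‖₊ ≤ q' ^ n := by exact_mod_cast h1
    exact_mod_cast h2
  obtain ⟨n₀, hn₀⟩ := eventually_atTop.1 hev
  have hq0' : (0 : ℝ) < q' := by exact_mod_cast hq0
  -- The finitely many small exponents are absorbed into the constant.
  refine ⟨1 + ∑ k ∈ Finset.range n₀, ‖a ^ k‖ / (q' : ℝ) ^ k, q', by positivity, hq0',
    by exact_mod_cast hq2', fun n => ?_⟩
  have hpow : 0 < (q' : ℝ) ^ n := by positivity
  have hS : 0 ≤ ∑ k ∈ Finset.range n₀, ‖a ^ k‖ / (q' : ℝ) ^ k := by positivity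
  rcases lt_or_ge n n₀ with hn | hn
  · have h1 : ‖a ^ n‖ / (q' : ℝ) ^ n ≤ ∑ k ∈ Finset.range n₀, ‖a ^ k‖ / (q' : ℝ) ^ k :=
      Finset.single_le_sum (f := fun k => ‖a ^ k‖ / (q' : ℝ) ^ k)
        (fun k _ => by positivity) (Finset.mem_range.2 hn)
    rw [div_le_iff₀ hpow] at h1
    nlinarith
  · nlinarith [hn₀ n hn]

namespace DelayPdE

/-! ### The step operator of the scalar delay equation -/

/-- Continuous complex functions on the unit interval, the state space of the scalar delay
equation with its delay rescaled to one. -/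
abbrev Profile : Type := C(Set.Icc (0 : ℝ) 1, ℂ)

/-- The extension of a profile to the real line which is constant on either side of the
unit interval. -/
noncomputable def Profile.extend (φ : Profile) : ℝ → ℂ := Set.IccExtend zero_le_one φ

theorem Profile.continuous_extend (φ : Profile) : Continuous φ.extend :=
  φ.continuous.Icc_extend'

theorem Profile.extend_of_mem (φ : Profile) {x : ℝ} (hx : x ∈ Set.Icc (0 : ℝ) 1) :
    φ.extend x = φ ⟨x, hx⟩ := Set.IccExtend_of_mem _ _ hx

theorem Profile.norm_extend_le (φ : Profile) (x : ℝ) : ‖φ.extend x‖ ≤ ‖φ‖ :=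
  φ.norm_coe_le_norm _

theorem Profile.norm_integral_extend_le (φ : Profile) (x y : ℝ) :
    ‖∫ r in x..y, φ.extend r‖ ≤ ‖φ‖ * |y - x| :=
  intervalIntegral.norm_integral_le_of_norm_le_const fun r _ => φ.norm_extend_le r

/-- The linear map `φ ↦ (s ↦ φ 1 - c ∫₀ˢ φ)`. -/
noncomputable def stepLinear (c : ℝ) : Profile →ₗ[ℂ] Profile where
  toFun φ := ⟨fun s => φ 1 - c * ∫ r in (0 : ℝ)..s, φ.extend r, by
    have : Continuous fun s : ℝ => ∫ r in (0 : ℝ)..s, φ.extend r :=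
      intervalIntegral.continuous_primitive
        (fun a b => φ.continuous_extend.intervalIntegrable a b) 0
    fun_prop⟩
  map_add' φ ψ := by
    ext s
    have h : ∫ r in (0 : ℝ)..s, (φ + ψ).extend r =
        (∫ r in (0 : ℝ)..s, φ.extend r) + ∫ r in (0 : ℝ)..s, ψ.extend r :=
      intervalIntegral.integral_add (φ.continuous_extend.intervalIntegrable _ _)
        (ψ.continuous_extend.intervalIntegrable _ _)
    simp only [ContinuousMap.coe_mk, ContinuousMap.add_apply, h]
    ring
  map_smul' k φ := by
    ext s
    have h : ∫ r in (0 : ℝ)..s, (k • φ).extend r = k * ∫ r in (0 : ℝ)..s, φ.extend r :=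
      intervalIntegral.integral_const_mul k φ.extend
    simp only [ContinuousMap.coe_mk, ContinuousMap.smul_apply, h, smul_eq_mul, RingHom.id_apply]
    ring

theorem norm_stepLinear_le (c : ℝ) (φ : Profile) : ‖stepLinear c φ‖ ≤ (1 + |c|) * ‖φ‖ := by
  rw [ContinuousMap.norm_le _ (by positivity)]
  intro s
  have h1 := φ.norm_integral_extend_le 0 s
  have h2 : |(s : ℝ) - 0| ≤ 1 := by
    rw [sub_zero, abs_of_nonneg s.2.1]; exact s.2.2
  have h3 : ‖(c : ℂ) * ∫ r in (0 : ℝ)..s, φ.extend r‖ ≤ |c| * ‖φ‖ := by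
    rw [norm_mul, Complex.norm_real, Real.norm_eq_abs]
    exact mul_le_mul_of_nonneg_left
      (h1.trans (mul_le_of_le_one_right (norm_nonneg _) h2)) (abs_nonneg _)
  calc ‖φ 1 - c * ∫ r in (0 : ℝ)..s, φ.extend r‖
      ≤ ‖φ 1‖ + ‖(c : ℂ) * ∫ r in (0 : ℝ)..s, φ.extend r‖ := norm_sub_le _ _
    _ ≤ ‖φ‖ + |c| * ‖φ‖ := add_le_add (φ.norm_coe_le_norm 1) h3
    _ = (1 + |c|) * ‖φ‖ := by ring

/-- The step operator `φ ↦ (s ↦ φ 1 - c ∫₀ˢ φ)`: it sends the restriction of a solution of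
`u' (t) = -c u (t - 1)` to one unit interval to its restriction to the next. -/
noncomputable def stepOp (c : ℝ) : Profile →L[ℂ] Profile :=
  (stepLinear c).mkContinuous (1 + |c|) (norm_stepLinear_le c)

theorem stepOp_apply (c : ℝ) (φ : Profile) (s : Set.Icc (0 : ℝ) 1) :
    stepOp c φ s = φ 1 - c * ∫ r in (0 : ℝ)..s, φ.extend r := rfl

theorem lipschitzWith_stepOp_apply (c : ℝ) {φ : Profile} (hφ : ‖φ‖ ≤ 1) :
    LipschitzWith ‖c‖₊ (stepOp c φ) := by
  refine LipschitzWith.of_dist_le_mul fun s t => ?_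
  have h1 := φ.norm_integral_extend_le t s
  have h2 : stepOp c φ s - stepOp c φ t = -(c * ∫ r in (t : ℝ)..s, φ.extend r) := by
    rw [stepOp_apply, stepOp_apply, ← intervalIntegral.integral_interval_sub_left
      (φ.continuous_extend.intervalIntegrable 0 s) (φ.continuous_extend.intervalIntegrable 0 t)]
    ring
  rw [dist_eq_norm, h2, norm_neg, norm_mul, Complex.norm_real, Subtype.dist_eq, Real.dist_eq,
    coe_nnnorm]
  exact mul_le_mul_of_nonneg_left
    (h1.trans (mul_le_of_le_one_left (abs_nonneg _) hφ)) (norm_nonneg _)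

/-- The image of the unit ball is bounded and equi-Lipschitz, so the Arzelà–Ascoli theorem
applies. -/
theorem isCompactOperator_stepOp (c : ℝ) : IsCompactOperator (stepOp c) := by
  let e := ContinuousMap.isometryEquivBoundedOfCompact (Set.Icc (0 : ℝ) 1) ℂ
  let A := (fun φ => e (stepOp c φ)) '' Metric.closedBall (0 : Profile) 1
  have hA : IsCompact (closure A) := by
    refine BoundedContinuousFunction.arzela_ascoli (Metric.closedBall (0 : ℂ) (1 + |c|))
      (isCompact_closedBall _ _) A ?_ ?_
    · rintro _ s ⟨φ, hφ, rfl⟩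
      rw [mem_closedBall_zero_iff] at hφ ⊢
      calc ‖stepOp c φ s‖ ≤ ‖stepOp c φ‖ := (stepOp c φ).norm_coe_le_norm s
        _ ≤ (1 + |c|) * ‖φ‖ := norm_stepLinear_le c φ
        _ ≤ 1 + |c| := mul_le_of_le_one_right (by positivity) hφ
    · refine (LipschitzWith.uniformEquicontinuous _ ‖c‖₊ ?_).equicontinuous
      rintro ⟨_, φ, hφ, rfl⟩
      exact lipschitzWith_stepOp_apply c (mem_closedBall_zero_iff.1 hφ)
  refine ⟨e.symm '' closure A, hA.image e.symm.continuous,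
    mem_of_superset (Metric.closedBall_mem_nhds 0 one_pos) fun φ hφ => ?_⟩
  exact ⟨e (stepOp c φ), subset_closure ⟨φ, hφ, rfl⟩, e.symm_apply_apply _⟩

/-- An eigenfunction for `μ ≠ 0` satisfies `φ' = -(c / μ) φ` and `φ 1 = μ φ 0`, which gives the
characteristic equation. -/
theorem exp_eq_of_hasEigenvalue_stepOp {c : ℝ} {μ : ℂ} (hμ : μ ≠ 0)
    (h : Module.End.HasEigenvalue (stepOp c : Module.End ℂ Profile) μ) :
    Complex.exp (-c / μ) = μ := by
  obtain ⟨φ, hφ⟩ := h.exists_hasEigenvector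
  have hne : φ ≠ 0 := hφ.2
  have heq : stepOp c φ = μ • φ := hφ.apply_eq_smul
  have hval (s : Set.Icc (0 : ℝ) 1) :
      μ * φ s = φ 1 - c * ∫ r in (0 : ℝ)..s, φ.extend r := by
    rw [← stepOp_apply, heq, ContinuousMap.smul_apply, smul_eq_mul]
  -- The right-hand side divided by `μ` extends `φ` to a differentiable function on the line.
  let g : ℝ → ℂ := fun s => (φ 1 - c * ∫ r in (0 : ℝ)..s, φ.extend r) / μ
  have hg (s : ℝ) (hs : s ∈ Set.Icc (0 : ℝ) 1) : g s = φ.extend s := by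
    rw [φ.extend_of_mem hs, ← mul_div_cancel_left₀ (φ ⟨s, hs⟩) hμ, hval]
  have hderiv (s : ℝ) : HasDerivAt g (-c / μ * φ.extend s) s := by
    have h1 := (intervalIntegral.integral_hasDerivAt_right
      (φ.continuous_extend.intervalIntegrable 0 s)
      (φ.continuous_extend.stronglyMeasurableAtFilter _ _) φ.continuous_extend.continuousAt)
    refine (((h1.const_mul (c : ℂ)).const_sub (φ 1)).div_const μ).congr_deriv ?_
    ring
  let E : ℝ → ℂ := fun s => g s * Complex.exp (-(-c / μ * s))
  have hE (s : ℝ) (hs : s ∈ Set.Icc (0 : ℝ) 1) : HasDerivAt E 0 s := by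
    have h1 : HasDerivAt (fun s : ℝ => Complex.exp (-(-c / μ * s)))
        (Complex.exp (-(-c / μ * s)) * (-(-c / μ * 1))) s :=
      (((HasDerivAt.ofReal_comp (hasDerivAt_id s)).const_mul (-c / μ)).neg).cexp
    refine ((hderiv s).mul h1).congr_deriv ?_
    rw [hg s hs]
    ring
  have hconst : ∀ s ∈ Set.Icc (0 : ℝ) 1, E s = E 0 :=
    constant_of_has_deriv_right_zero
      (fun s hs => (hE s hs).continuousAt.continuousWithinAt)
      (fun s hs => (hE s (Set.Ico_subset_Icc_self hs)).hasDerivWithinAt)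
  have hE0 : E 0 = g 0 := by simp [E]
  have hsol (s : ℝ) (hs : s ∈ Set.Icc (0 : ℝ) 1) : g s = g 0 * Complex.exp (-c / μ * s) := by
    rw [← hE0, ← hconst s hs, mul_assoc, ← Complex.exp_add]
    simp
  have hg0 : g 0 ≠ 0 := by
    intro h0
    apply hne
    ext s
    have := hsol s s.2
    rwa [h0, zero_mul, hg s s.2, φ.extend_of_mem s.2] at this
  have h0 : g 0 = φ 1 / μ := by simp [g]
  have h1 : g 1 = φ 1 := (hg 1 (by simp)).trans (φ.extend_of_mem (by simp))
  have h2 : g 0 * Complex.exp (-c / μ) = g 0 * μ := by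
    have := hsol 1 (by simp)
    rw [Complex.ofReal_one, mul_one] at this
    rw [← this, h1, h0, div_mul_cancel₀ _ hμ]
  exact mul_left_cancel₀ hg0 h2

/-- Roots of the characteristic equation lie inside the unit disc when `0 < c < π / 2`. If
`|μ| ≥ 1`, then `z = -c / μ` satisfies `|Im z| ≤ c < π / 2`, so that `μ = exp z` has positive real
part; then `Re z < 0`, and `|μ| = exp (Re z) < 1`. -/
theorem norm_lt_one_of_exp_eq {c : ℝ} (hc : 0 < c) (hc' : c < Real.pi / 2) {μ : ℂ}
    (h : Complex.exp (-c / μ) = μ) : ‖μ‖ < 1 := by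
  by_contra! hμ
  have hμ0 : μ ≠ 0 := norm_pos_iff.1 (one_pos.trans_le hμ)
  have hz : ‖-(c : ℂ) / μ‖ ≤ c := by
    rw [norm_div, norm_neg, Complex.norm_real, Real.norm_of_nonneg hc.le]
    exact div_le_self hc.le hμ
  have him : |(-(c : ℂ) / μ).im| < Real.pi / 2 :=
    ((Complex.abs_im_le_norm _).trans hz).trans_lt hc'
  have hre : 0 < μ.re := by
    rw [← h, Complex.exp_re]
    exact mul_pos (Real.exp_pos _) (Real.cos_pos_of_mem_Ioo (abs_lt.1 him))
  have hzre : (-(c : ℂ) / μ).re < 0 := by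
    have h1 : (-(c : ℂ) / μ).re = -(c * (μ.re / Complex.normSq μ)) := by
      rw [neg_div, Complex.neg_re, div_eq_mul_inv, Complex.re_ofReal_mul, Complex.inv_re]
    rw [h1]
    have := Complex.normSq_pos.2 hμ0
    exact neg_neg_of_pos (by positivity)
  have : ‖μ‖ < 1 := by
    rw [← h, Complex.norm_exp]
    exact Real.exp_lt_one_iff.2 hzre
  exact absurd hμ this.not_ge

theorem spectralRadius_stepOp_lt_one {c : ℝ} (hc : 0 < c) (hc' : c < Real.pi / 2) :
    spectralRadius ℂ (stepOp c) < 1 := by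
  refine spectrum.spectralRadius_lt_of_forall_lt (stepOp c) (r := 1) fun μ hμ => ?_
  rcases eq_or_ne μ 0 with rfl | hμ0
  · simp
  · rcases (isCompactOperator_stepOp c).hasEigenvalue_or_mem_resolventSet hμ0 with h | h
    · have := norm_lt_one_of_exp_eq hc hc' (exp_eq_of_hasEigenvalue_stepOp hμ0 h)
      exact_mod_cast this
    · exact absurd h hμ

theorem exists_norm_stepOp_pow_le {c : ℝ} (hc : 0 < c) (hc' : c < Real.pi / 2) :
    ∃ C q : ℝ, 0 < C ∧ 0 < q ∧ q < 1 ∧ ∀ n : ℕ, ‖stepOp c ^ n‖ ≤ C * q ^ n :=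
  exists_norm_pow_le_of_spectralRadius_lt_one (A := Profile →L[ℂ] Profile) (stepOp c)
    (spectralRadius_stepOp_lt_one hc hc')

/-! ### The scalar delay equation -/

/-- `u` solves the scalar equation `u' (t) = -a u (t - τ)` for `t > 0`, and is continuous on
`[-τ, ∞)`. -/
structure IsScalarSolution (a τ : ℝ) (u : ℝ → ℝ) : Prop where
  continuousOn : ContinuousOn u (Set.Ici (-τ))
  hasDerivAt : ∀ t : ℝ, 0 < t → HasDerivAt u (-a * u (t - τ)) t

namespace IsScalarSolution

variable {a τ : ℝ} {u : ℝ → ℝ}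

/-- The restriction of a solution to the interval `[(n - 1) τ, n τ]`, rescaled to `[0, 1]`. -/
noncomputable def profile (hu : IsScalarSolution a τ u) (hτ : 0 < τ) (n : ℕ) : Profile where
  toFun s := (u (τ * (s + n - 1)) : ℂ)
  continuous_toFun := by
    refine Complex.continuous_ofReal.comp (hu.continuousOn.comp_continuous (by fun_prop) ?_)
    intro s
    have h0 : (0 : ℝ) ≤ s := s.2.1
    have hn : (0 : ℝ) ≤ n := Nat.cast_nonneg n
    rw [Set.mem_Ici]
    nlinarith

theorem profile_succ (hu : IsScalarSolution a τ u) (hτ : 0 < τ) (n : ℕ) :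
    hu.profile hτ (n + 1) = stepOp (a * τ) (hu.profile hτ n) := by
  ext s
  have hs0 : (0 : ℝ) ≤ s := s.2.1
  have hn : (0 : ℝ) ≤ n := Nat.cast_nonneg n
  have hcont : ContinuousOn (fun x : ℝ => (u (τ * (x + n)) : ℂ)) (Set.Icc 0 s) := by
    refine Complex.continuous_ofReal.comp_continuousOn
      (hu.continuousOn.comp (by fun_prop) fun x hx => ?_)
    have := hx.1
    rw [Set.mem_Ici]
    nlinarith
  have hderiv : ∀ x ∈ Set.Ioo (0 : ℝ) s, HasDerivAt (fun x : ℝ => (u (τ * (x + n)) : ℂ))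
      (-(a * τ : ℝ) * (hu.profile hτ n).extend x) x := by
    intro x hx
    have hpos : 0 < τ * (x + n) := mul_pos hτ (by linarith [hx.1])
    have h1 : HasDerivAt (fun x : ℝ => τ * (x + n)) (τ * 1) x :=
      ((hasDerivAt_id x).add_const _).const_mul τ
    have h2 := ((hu.hasDerivAt _ hpos).comp x h1).ofReal_comp
    refine h2.congr_deriv ?_
    rw [Profile.extend_of_mem _ ⟨hx.1.le, hx.2.le.trans s.2.2⟩]
    have h3 : τ * (x + n) - τ = τ * (x + n - 1) := by ring
    simp only [profile, ContinuousMap.coe_mk, h3]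
    push_cast
    ring
  have hint := intervalIntegral.integral_eq_sub_of_hasDerivAt_of_le hs0 hcont hderiv
    ((continuous_const.mul (hu.profile hτ n).continuous_extend).intervalIntegrable _ _)
  rw [intervalIntegral.integral_const_mul] at hint
  have h1 : hu.profile hτ (n + 1) s = (u (τ * (s + n)) : ℂ) := by
    simp only [profile, ContinuousMap.coe_mk]
    congr 2
    push_cast
    ring
  have h2 : hu.profile hτ n 1 = (u (τ * (0 + n)) : ℂ) := by
    simp only [profile, ContinuousMap.coe_mk, Set.Icc.coe_one]
    congr 2
    ring
  rw [stepOp_apply, h1, h2]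
  linear_combination -hint

theorem profile_eq_pow (hu : IsScalarSolution a τ u) (hτ : 0 < τ) (n : ℕ) :
    hu.profile hτ n = (stepOp (a * τ) ^ n) (hu.profile hτ 0) := by
  induction n with
  | zero => simp
  | succ n ih => rw [profile_succ, ih, pow_succ', mul_apply_eq_comp]

end IsScalarSolution

theorem exists_scalar_decay_of_delay_pos {a τ : ℝ} (ha : 0 < a) (hτ : 0 < τ)
    (h : a * τ < Real.pi / 2) :
    ∃ K γ : ℝ, 0 < K ∧ 0 < γ ∧ ∀ (u : ℝ → ℝ) (M : ℝ), IsScalarSolution a τ u →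
      (∀ s ∈ Set.Icc (-τ) 0, |u s| ≤ M) → ∀ t : ℝ, 0 ≤ t → |u t| ≤ K * Real.exp (-γ * t) * M := by
  obtain ⟨C, q, hC, hq, hq1, hpow⟩ := exists_norm_stepOp_pow_le (mul_pos ha hτ) h
  refine ⟨C, -Real.log q / τ, hC, div_pos (neg_pos.2 (Real.log_neg hq hq1)) hτ,
    fun u M hu hM t ht => ?_⟩
  have hM0 : 0 ≤ M := (abs_nonneg _).trans (hM 0 ⟨by linarith, le_rfl⟩)
  have hinit : ‖hu.profile hτ 0‖ ≤ M := by
    rw [ContinuousMap.norm_le _ hM0]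
    intro s
    have hs0 : (0 : ℝ) ≤ s := s.2.1
    have hs1 : (s : ℝ) ≤ 1 := s.2.2
    simp only [IsScalarSolution.profile, ContinuousMap.coe_mk, Complex.norm_real,
      Real.norm_eq_abs]
    apply hM
    constructor <;> push_cast <;> nlinarith
  -- The time `t = τ (s + n)` lies at position `s` of the profile of index `n + 1`.
  set n := ⌊t / τ⌋₊ with hn
  have hnle : (n : ℝ) ≤ t / τ := Nat.floor_le (by positivity)
  have hnlt : t / τ < n + 1 := Nat.lt_floor_add_one _
  let s : Set.Icc (0 : ℝ) 1 := ⟨t / τ - n, by linarith, by linarith⟩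
  have hval : hu.profile hτ (n + 1) s = (u t : ℂ) := by
    simp only [IsScalarSolution.profile, ContinuousMap.coe_mk, s]
    congr 2
    push_cast
    field_simp
    ring
  have h1 : |u t| ≤ C * q ^ (n + 1) * M := by
    calc |u t| = ‖hu.profile hτ (n + 1) s‖ := by rw [hval, Complex.norm_real, Real.norm_eq_abs]
      _ ≤ ‖hu.profile hτ (n + 1)‖ := ContinuousMap.norm_coe_le_norm _ s
      _ = ‖(stepOp (a * τ) ^ (n + 1)) (hu.profile hτ 0)‖ := by rw [hu.profile_eq_pow]
      _ ≤ ‖stepOp (a * τ) ^ (n + 1)‖ * ‖hu.profile hτ 0‖ := ContinuousLinearMap.le_opNorm _ _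
      _ ≤ C * q ^ (n + 1) * M := by gcongr; exact hpow _
  have h2 : q ^ (n + 1) ≤ Real.exp (-(-Real.log q / τ) * t) := by
    have h3 : q ^ (n + 1) = Real.exp (Real.log q * (n + 1)) := by
      rw [← Real.rpow_natCast, Real.rpow_def_of_pos hq]
      push_cast
      rfl
    rw [h3, Real.exp_le_exp]
    calc Real.log q * (n + 1) ≤ Real.log q * (t / τ) :=
          mul_le_mul_of_nonpos_left hnlt.le (Real.log_neg hq hq1).le
      _ = -(-Real.log q / τ) * t := by ring
  exact h1.trans (by gcongr)

theorem scalar_decay_of_delay_zero {a : ℝ} {u : ℝ → ℝ} (hu : IsScalarSolution a 0 u) {t : ℝ}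
    (ht : 0 ≤ t) : u t = Real.exp (-a * t) * u 0 := by
  have hcont : ContinuousOn (fun x => u x * Real.exp (a * x)) (Set.Icc 0 t) :=
    (hu.continuousOn.mono fun x hx => by simpa using hx.1).mul (by fun_prop)
  have hderiv : ∀ x ∈ Set.Ioo 0 t, HasDerivAt (fun x => u x * Real.exp (a * x)) 0 x := by
    intro x hx
    have h1 : HasDerivAt (fun x => Real.exp (a * x)) (Real.exp (a * x) * (a * 1)) x :=
      ((hasDerivAt_id x).const_mul a).exp
    refine ((hu.hasDerivAt x hx.1).mul h1).congr_deriv ?_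
    rw [sub_zero]
    ring
  have hint := intervalIntegral.integral_eq_sub_of_hasDerivAt_of_le ht hcont hderiv
    (by simp)
  have h0 : u t * Real.exp (a * t) = u 0 := by
    simpa [eq_comm (a := (0 : ℝ)), sub_eq_zero] using hint
  rw [← h0, mul_left_comm, ← Real.exp_add]
  simp

/-- Exponential stability of the scalar equation `u' (t) = -a u (t - τ)` for `a τ < π / 2`, with
constants that do not depend on the solution. -/
theorem exists_scalar_decay {a τ : ℝ} (ha : 0 < a) (hτ : 0 ≤ τ) (h : a * τ < Real.pi / 2) :
    ∃ K γ : ℝ, 0 < K ∧ 0 < γ ∧ ∀ (u : ℝ → ℝ) (M : ℝ), IsScalarSolution a τ u →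
      (∀ s ∈ Set.Icc (-τ) 0, |u s| ≤ M) → ∀ t : ℝ, 0 ≤ t → |u t| ≤ K * Real.exp (-γ * t) * M := by
  rcases hτ.eq_or_lt with rfl | hτ
  · refine ⟨1, a, one_pos, ha, fun u M hu hM t ht => ?_⟩
    rw [scalar_decay_of_delay_zero hu ht, abs_mul, Real.abs_exp, one_mul]
    exact mul_le_mul_of_nonneg_left (hM 0 (by simp)) (Real.exp_pos _).le
  · exact exists_scalar_decay_of_delay_pos ha hτ h

/-! ### The spectrum of the Laplacian -/

section Spectrum

variable {N d : ℕ} (G : WeightedGraph N)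

/-- Green's formula: the quadratic form of the Laplacian is minus one half of the Dirichlet
form. -/
theorem inner_laplacian (f g : L2 N d) :
    inner ℝ (laplacian G d f) g =
      -(1 / 2) * ∑ x, ∑ y, G.weight x y * inner ℝ (f y - f x) (g y - g x) := by
  have h1 : inner ℝ (laplacian G d f) g =
      ∑ x, ∑ y, G.weight x y * inner ℝ (f y - f x) (g x) := by
    rw [L2.inner_eq_sum]
    refine Finset.sum_congr rfl fun x _ => ?_
    change inner ℝ (∑ y, G.weight x y • partialDeriv y f x) (g x) = _
    rw [sum_inner]
    exact Finset.sum_congr rfl fun y _ => real_inner_smul_left _ _ _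
  have h2 : ∑ x, ∑ y, G.weight x y * inner ℝ (f y - f x) (g x) =
      -∑ x, ∑ y, G.weight x y * inner ℝ (f y - f x) (g y) := by
    rw [Finset.sum_comm, ← Finset.sum_neg_distrib]
    refine Finset.sum_congr rfl fun x _ => ?_
    rw [← Finset.sum_neg_distrib]
    refine Finset.sum_congr rfl fun y _ => ?_
    rw [G.weight_symm y x, ← neg_sub (f y) (f x), inner_neg_left]
    ring
  simp only [inner_sub_right, mul_sub, Finset.sum_sub_distrib]
  rw [h1]
  linarith

theorem laplacianH1_isSymmetric : (laplacianH1 G d).IsSymmetric := by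
  intro f g
  change inner ℝ (laplacian G d (f : L2 N d)) (g : L2 N d) =
    inner ℝ (f : L2 N d) (laplacian G d (g : L2 N d))
  rw [real_inner_comm (laplacian G d (g : L2 N d)), inner_laplacian, inner_laplacian]
  simp only [real_inner_comm]

variable {G}

/-- The Dirichlet form of a function that is not constant on a connected graph is positive, and a
nonzero function with zero average is not constant. -/
theorem inner_laplacianH1_self_neg (hG : G.Connected) {f : H1 N d} (hf : f ≠ 0) :
    inner ℝ (laplacianH1 G d f) f < 0 := by
  have hform : inner ℝ (laplacianH1 G d f) f = -(1 / 2) * ∑ x, ∑ y, G.weight x y *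
      inner ℝ ((f : L2 N d) y - (f : L2 N d) x) ((f : L2 N d) y - (f : L2 N d) x) :=
    inner_laplacian G (f : L2 N d) (f : L2 N d)
  have hnn : ∀ x y, 0 ≤ G.weight x y *
      inner ℝ ((f : L2 N d) y - (f : L2 N d) x) ((f : L2 N d) y - (f : L2 N d) x) := fun x y =>
    mul_nonneg (G.weight_nonneg x y) real_inner_self_nonneg
  have hsum := Finset.sum_nonneg fun x (_ : x ∈ Finset.univ) =>
    Finset.sum_nonneg fun y (_ : y ∈ Finset.univ) => hnn x y
  by_contra! hge
  have hzero : ∑ x, ∑ y, G.weight x y *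
      inner ℝ ((f : L2 N d) y - (f : L2 N d) x) ((f : L2 N d) y - (f : L2 N d) x) = 0 := by
    linarith
  have hadj : ∀ x y, G.Adj x y → (f : L2 N d) y = (f : L2 N d) x := by
    intro x y hxy
    have h1 := (Finset.sum_eq_zero_iff_of_nonneg fun x _ =>
      Finset.sum_nonneg fun y _ => hnn x y).1 hzero x (Finset.mem_univ x)
    have h2 := (Finset.sum_eq_zero_iff_of_nonneg fun y _ => hnn x y).1 h1 y (Finset.mem_univ y)
    have h3 := (mul_eq_zero.1 h2).resolve_left ((G.weight_pos_iff x y).2 hxy).ne'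
    exact sub_eq_zero.1 (inner_self_eq_zero.1 h3)
  have hconst : ∀ x y, (f : L2 N d) y = (f : L2 N d) x := by
    intro x y
    induction hG x y with
    | refl => rfl
    | tail _ hbc ih => exact (hadj _ _ hbc).trans ih
  have hav : (N : ℝ)⁻¹ • ∑ x, (f : L2 N d) x = 0 := f.2
  apply hf
  ext1
  ext1 x
  have hN : (N : ℝ) ≠ 0 := Nat.cast_ne_zero.2 (Fin.pos x).ne'
  rw [Finset.sum_congr rfl fun y _ => hconst x y, Finset.sum_const, Finset.card_univ,
    Fintype.card_fin, ← Nat.cast_smul_eq_nsmul ℝ, smul_smul, inv_mul_cancel₀ hN, one_smul] at hav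
  exact hav

theorem eigenvalue_laplacianH1_neg (hG : G.Connected) {μ : ℝ}
    (hμ : Module.End.HasEigenvalue (laplacianH1 G d) μ) : μ < 0 := by
  obtain ⟨f, hf⟩ := hμ.exists_hasEigenvector
  have h1 := inner_laplacianH1_self_neg hG hf.2
  rw [hf.apply_eq_smul, real_inner_smul_left] at h1
  exact neg_of_mul_neg_left h1 real_inner_self_nonneg

theorem finite_eigenvalue_moduli (G : WeightedGraph N) :
    {r : ℝ | ∃ μ : ℝ, Module.End.HasEigenvalue (laplacianH1 G d) μ ∧ r = |μ|}.Finite := by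
  refine ((Module.End.finite_hasEigenvalue (laplacianH1 G d)).image fun μ => |μ|).subset ?_
  rintro r ⟨μ, hμ, rfl⟩
  exact ⟨μ, hμ, rfl⟩

theorem abs_eigenvalue_le_laplacianNorm {μ : ℝ}
    (hμ : Module.End.HasEigenvalue (laplacianH1 G d) μ) : |μ| ≤ laplacianNorm G d :=
  le_csSup (finite_eigenvalue_moduli G).bddAbove ⟨μ, hμ, rfl⟩

theorem nontrivial_H1 (hN : 2 ≤ N) (hd : 1 ≤ d) : Nontrivial (H1 N d) := by
  let i : Fin N := ⟨0, by lia⟩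
  let j : Fin N := ⟨1, by lia⟩
  have hij : i ≠ j := by simp [i, j]
  let e : EuclideanSpace ℝ (Fin d) := EuclideanSpace.single ⟨0, hd⟩ 1
  have he : e ≠ 0 := by
    intro h
    have : ‖e‖ = 1 := by simp [e]
    simp [h] at this
  let f : L2 N d := L2.ofFun fun x => (if x = i then e else 0) - (if x = j then e else 0)
  have hf : f ∈ H1 N d := by
    change (N : ℝ)⁻¹ • ∑ x, ((if x = i then e else 0) - (if x = j then e else 0)) = 0
    simp [Finset.sum_sub_distrib]
  refine ⟨⟨f, hf⟩, 0, fun h => he ?_⟩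
  have h1 : f i = 0 := by
    have h2 : f = 0 := congrArg Subtype.val h
    rw [h2, L2.zero_apply]
  simpa [f, hij] using h1

/-- The supremum defining `laplacianNorm` is attained, at the negative of an eigenvalue. -/
theorem hasEigenvalue_neg_laplacianNorm (hN : 2 ≤ N) (hd : 1 ≤ d) (hG : G.Connected) :
    Module.End.HasEigenvalue (laplacianH1 G d) (-laplacianNorm G d) := by
  have := nontrivial_H1 hN hd
  have hne : {r : ℝ | ∃ μ : ℝ, Module.End.HasEigenvalue (laplacianH1 G d) μ ∧
      r = |μ|}.Nonempty :=
    ⟨_, _, (laplacianH1_isSymmetric G).hasEigenvalue_iSup_of_finiteDimensional, rfl⟩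
  obtain ⟨μ, hμ, h⟩ := hne.csSup_mem (finite_eigenvalue_moduli G)
  have h' : laplacianNorm G d = |μ| := h
  rwa [h', abs_of_neg (eigenvalue_laplacianH1_neg hG hμ), neg_neg]

end Spectrum

/-! ### Stability of the system -/

section Stability

variable {N d : ℕ} {G : WeightedGraph N}

/-- The component of a solution along an eigenvector solves a scalar delay equation. -/
theorem IsSolution.isScalarSolution_inner {τ τbar a : ℝ} {φ : C(Set.Icc (-τbar) 0, H1 N d)}
    {v : ℝ → H1 N d} (hv : IsSolution G τ τbar φ v) (hτ : τ ≤ τbar) {e : H1 N d}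
    (he : laplacianH1 G d e = -a • e) : IsScalarSolution a τ fun t => inner ℝ e (v t) where
  continuousOn := continuousOn_const.inner
    (hv.continuousOn.mono (Set.Ici_subset_Ici.2 (neg_le_neg hτ)))
  hasDerivAt t ht := by
    refine ((hasDerivAt_const t e).inner ℝ (hv.hasDerivAt t ht)).congr_deriv ?_
    rw [inner_zero_left, add_zero, ← laplacianH1_isSymmetric G, he, real_inner_smul_left]

theorem globallyExponentiallyStable_of_lt (hG : G.Connected) {τ τbar : ℝ} (hτ : 0 ≤ τ)
    (hττ : τ ≤ τbar) (h : ∀ μ, Module.End.HasEigenvalue (laplacianH1 G d) μ →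
      |μ| * τ < Real.pi / 2) :
    GloballyExponentiallyStable G d τ τbar := by
  have hsymm := laplacianH1_isSymmetric (d := d) G
  let b := hsymm.eigenvectorBasis rfl
  have hneg : ∀ i, hsymm.eigenvalues rfl i < 0 := fun i =>
    eigenvalue_laplacianH1_neg hG (hsymm.hasEigenvalue_eigenvalues rfl i)
  have hscalar := fun i => exists_scalar_decay (a := |hsymm.eigenvalues rfl i|)
    (abs_pos.2 (hneg i).ne) hτ
    (h _ (hsymm.hasEigenvalue_eigenvalues rfl i))
  choose K γ hK hγ hdecay using hscalar
  obtain ⟨γ₀, hγ₀, hγle⟩ : ∃ γ₀ : ℝ, 0 < γ₀ ∧ ∀ i, γ₀ ≤ γ i := by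
    have : ∀ᶠ x in 𝓝[>] (0 : ℝ), ∀ i, x ≤ γ i :=
      eventually_all.2 fun i => nhdsWithin_le_nhds (eventually_le_nhds (hγ i))
    obtain ⟨x, hx, hx0⟩ := (this.and self_mem_nhdsWithin).exists
    exact ⟨x, hx0, hx⟩
  have hKsum : 0 ≤ ∑ i, K i := Finset.sum_nonneg fun i _ => (hK i).le
  refine ⟨1 + ∑ i, K i, γ₀, by linarith, hγ₀, fun φ v hv t ht => ?_⟩
  have hcomp : ∀ i, ‖inner ℝ (b i) (v t) • b i‖ ≤ K i * (Real.exp (-γ₀ * t) * ‖φ‖) := by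
    intro i
    have heig : laplacianH1 G d (b i) = -|hsymm.eigenvalues rfl i| • b i := by
      rw [abs_of_neg (hneg i), neg_neg]
      exact hsymm.apply_eigenvectorBasis rfl i
    have hinit : ∀ s ∈ Set.Icc (-τ) 0, |inner ℝ (b i) (v s)| ≤ ‖φ‖ := by
      intro s hs
      have h1 : v s = φ ⟨s, (neg_le_neg hττ).trans hs.1, hs.2⟩ := hv.initial ⟨s, _⟩
      calc |inner ℝ (b i) (v s)| ≤ ‖b i‖ * ‖v s‖ := abs_real_inner_le_norm _ _
        _ = ‖v s‖ := by rw [b.orthonormal.1 i, one_mul]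
        _ ≤ ‖φ‖ := by rw [h1]; exact φ.norm_coe_le_norm _
    rw [norm_smul, b.orthonormal.1 i, mul_one, Real.norm_eq_abs, ← mul_assoc]
    refine (hdecay i _ _ (hv.isScalarSolution_inner hττ heig) hinit t ht).trans ?_
    have := (hK i).le
    have := hγle i
    gcongr
  have hexp : 0 ≤ Real.exp (-γ₀ * t) * ‖φ‖ := by positivity
  calc ‖v t‖ = ‖∑ i, inner ℝ (b i) (v t) • b i‖ := by rw [b.sum_repr' (v t)]
    _ ≤ ∑ i, ‖inner ℝ (b i) (v t) • b i‖ := norm_sum_le _ _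
    _ ≤ ∑ i, K i * (Real.exp (-γ₀ * t) * ‖φ‖) := Finset.sum_le_sum fun i _ => hcomp i
    _ = (∑ i, K i) * (Real.exp (-γ₀ * t) * ‖φ‖) := (Finset.sum_mul _ _ _).symm
    _ ≤ (1 + ∑ i, K i) * Real.exp (-γ₀ * t) * ‖φ‖ := by linarith

/-- At the critical delay `π / (2 L)`, an eigenvalue `-L` gives the undamped oscillation
`t ↦ cos (L t) e`. -/
theorem not_globallyExponentiallyStable_critical {L τbar : ℝ} (hL : 0 < L)
    (hev : Module.End.HasEigenvalue (laplacianH1 G d) (-L)) :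
    ¬ GloballyExponentiallyStable G d (Real.pi / (2 * L)) τbar := by
  rintro ⟨K, γ, hK, hγ, hstab⟩
  obtain ⟨e, he⟩ := hev.exists_hasEigenvector
  let v : ℝ → H1 N d := fun t => Real.cos (L * t) • e
  have hvc : Continuous v := by fun_prop
  let φ : C(Set.Icc (-τbar) 0, H1 N d) := ⟨fun s => v s, by fun_prop⟩
  have hsol : IsSolution G (Real.pi / (2 * L)) τbar φ v := by
    refine ⟨fun s => rfl, hvc.continuousOn, fun t _ => ?_⟩
    have h1 : HasDerivAt (fun t : ℝ => Real.cos (L * t)) (-Real.sin (L * t) * (L * 1)) t :=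
      ((hasDerivAt_id t).const_mul L).cos
    refine (h1.smul_const e).congr_deriv ?_
    have h2 : L * (t - Real.pi / (2 * L)) = L * t - Real.pi / 2 := by
      field_simp
    simp only [v]
    rw [map_smul, he.apply_eq_smul, smul_smul, h2, Real.cos_sub_pi_div_two]
    congr 1
    ring
  have hbound : ∀ n : ℕ, ‖e‖ ≤ K * Real.exp (-γ * (n * (2 * Real.pi) / L)) * ‖φ‖ := by
    intro n
    have h1 := hstab φ v hsol (n * (2 * Real.pi) / L) (by positivity)
    have h2 : v (n * (2 * Real.pi) / L) = e := by
      simp only [v]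
      rw [mul_div_cancel₀ _ hL.ne', Real.cos_nat_mul_two_pi, one_smul]
    rwa [h2] at h1
  have htime : Tendsto (fun n : ℕ => (n : ℝ) * (2 * Real.pi) / L) atTop atTop :=
    (tendsto_natCast_atTop_atTop.atTop_mul_const (by positivity)).atTop_div_const hL
  have hlim : Tendsto (fun n : ℕ => K * Real.exp (-γ * (n * (2 * Real.pi) / L)) * ‖φ‖) atTop
      (𝓝 (K * 0 * ‖φ‖)) :=
    ((Real.tendsto_exp_atBot.comp
      (htime.const_mul_atTop_of_neg (neg_lt_zero.2 hγ))).const_mul K).mul_const _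
  rw [mul_zero, zero_mul] at hlim
  exact he.2 (norm_le_zero_iff.1 (ge_of_tendsto' hlim hbound))

end Stability

end DelayPdE

theorem mainTheorem3 (N d : ℕ) (hN : 2 ≤ N) (hd : 1 ≤ d)
    (G : DelayPdE.WeightedGraph N) (hG : G.Connected) (τbar : ℝ) (hτbar : 0 ≤ τbar) :
    (∀ τ : ℝ, 0 ≤ τ → τ ≤ τbar → DelayPdE.GloballyExponentiallyStable G d τ τbar) ↔
      τbar < Real.pi / (2 * DelayPdE.laplacianNorm G d) := by
  have hev := DelayPdE.hasEigenvalue_neg_laplacianNorm hN hd hG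
  have hL : 0 < DelayPdE.laplacianNorm G d :=
    neg_lt_zero.1 (DelayPdE.eigenvalue_laplacianH1_neg hG hev)
  constructor
  · intro h
    by_contra! hle
    exact DelayPdE.not_globallyExponentiallyStable_critical hL hev
      (h _ (by positivity) hle)
  · intro h τ hτ hττ
    refine DelayPdE.globallyExponentiallyStable_of_lt hG hτ hττ fun μ hμ => ?_
    rw [lt_div_iff₀ (by positivity)] at h
    have h1 : |μ| * τ ≤ DelayPdE.laplacianNorm G d * τbar := by
      gcongr
      exact DelayPdE.abs_eigenvalue_le_laplacianNorm hμ
    linarith
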